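/- Let $\mathcal X$ be a finite set and let $P_X\neq P_Y$ be probability distributions on $\mathcal X$, with $n$-fold product distributions $P_X^n,P_Y^n$ on $\mathcal X^n$. A coupling of two distributions is a joint distribution with these marginals, and $\mathcal M(P,Q)=\max\mathbb P\{X=Y\}$, the maximum being over all couplings $P_{XY}$ of $P$ and $Q$. Let $|P-Q|=\frac12\sum_x|P(x)-Q(x)|$ be the total variation distance, $D(\cdot\|\cdot)$ the relative entropy, and $$B(P_X,P_Y)=\max_{0\le\lambda\le1}\Big\{-\log\sum_{x:\,P_X(x)>0,\,P_Y(x)>0}P_X(x)^{\lambda}P_Y(x)^{1-\lambda}\Big\}$$ the Chernoff information. Logarithms are natural, $-\log 0=+\infty$, and exponents may be $+\infty$. Then the maxima defining $\mathcal M(P_X^n,P_Y^n)$ and $B(P_X,P_Y)$ are attained, and: 1. $\mathcal M(P_X^n,P_Y^n)\to0$ exponentially fast: there are $c>0$ and $C$ with $\mathcal M(P_X^n,P_Y^n)\le Ce^{-cn}$ for all $n$. The exact exponent is $$\lim_{n\to\infty}-\frac1n\log\mathcal M(P_X^n,P_Y^n)=\min_{Q}\max\{D(Q\|P_X),D(Q\|P_Y)\}=B(P_X,P_Y),$$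 where the minimum, over all probability distributions $Q$ on $\mathcal X$, is attained. 2. For every coupling $P_{XY}$ of $P_X,P_Y$, the product coupling $P_{XY}^n$ is a coupling of $P_X^n,P_Y^n$. If $P_{XY}$ attains $\mathcal M(P_X,P_Y)$, then under $P_{XY}^n$ the exponent $\lim_{n\to\infty}-\frac1n\log\mathbb P\{X^n=Y^n\}$ equals $-\log(1-|P_X-P_Y|)$, and this is the best (smallest) exponent achieved by any product coupling. It satisfies $$B(P_X,P_Y)\le-\log(1-|P_X-P_Y|),$$ and the inequality is strict for some pair of distinct distributions on a two-point set. -/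

import Mathlib

open Filter Topology
open scoped ENNReal

namespace MaximalCoupling

/-- The set of couplings of `P` and `Q`: joint distributions with marginals `P` and `Q`. -/
def couplings {α β : Type*} (P : PMF α) (Q : PMF β) : Set (PMF (α × β)) :=
  {π | π.map Prod.fst = P ∧ π.map Prod.snd = Q}

/-- The probability that `X = Y` when `(X, Y)` has joint distribution `π`. -/
noncomputable def eqProb {α : Type*} (π : PMF (α × α)) : ℝ≥0∞ :=
  π.toOuterMeasure {z | z.1 = z.2}

/-- The maximal equality probability over all couplings of `P` and `Q`. -/
noncomputable def maxEqProb {α : Type*} (P Q : PMF α) : ℝ≥0∞ :=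
  sSup (eqProb '' couplings P Q)

theorem sum_prod_eq_one {α : Type*} [Fintype α] (P : PMF α) (n : ℕ) :
    ∑ x : Fin n → α, ∏ i, P (x i) = 1 := by
  have h : ∑ a, P a = 1 := by rw [← tsum_fintype (L := .unconditional α)]; exact P.tsum_coe
  classical
  rw [← Fintype.piFinset_univ, ← Finset.prod_univ_sum]
  simp [h]

/-- The `n`-fold product distribution `P ^ n` on `α ^ n`, i.e. the law of `n` i.i.d. copies. -/
noncomputable def iid {α : Type*} [Fintype α] (P : PMF α) (n : ℕ) : PMF (Fin n → α) :=
  PMF.ofFintype (fun x => ∏ i, P (x i)) (sum_prod_eq_one P n)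

/-- The product coupling `π ^ n`: the joint law of `(X ^ n, Y ^ n)` when the pairs `(X i, Y i)`
are i.i.d. with law `π`. -/
noncomputable def prodCoupling {α : Type*} [Fintype α] (π : PMF (α × α)) (n : ℕ) :
    PMF ((Fin n → α) × (Fin n → α)) :=
  (iid π n).map fun z => (fun i => (z i).1, fun i => (z i).2)

/-- Total variation distance `(1/2) ∑ |P x - Q x|`. -/
noncomputable def tvDist {α : Type*} [Fintype α] (P Q : PMF α) : ℝ :=
  (1 / 2) * ∑ x, |(P x).toReal - (Q x).toReal|

/-- Relative entropy `D(R ‖ P)` of distributions on a discrete alphabet. -/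
noncomputable def relEntropy {α : Type*} (R P : PMF α) : ℝ≥0∞ :=
  letI : MeasurableSpace α := ⊤
  InformationTheory.klDiv R.toMeasure P.toMeasure

/-- `-log ∑ P x ^ t * Q x ^ (1 - t)`, with values in the extended reals and with `-log 0 = ⊤`.
A term with `P x = 0` or `Q x = 0` counts as `0`, also at `t = 0` and `t = 1` (this is the
continuous extension from `0 < t < 1`, for which the maximum over `[0, 1]` is attained). -/
noncomputable def chernoffFun {α : Type*} [Fintype α] (P Q : PMF α) (t : ℝ) : EReal :=
  -ENNReal.log (∑ x, if P x = 0 ∨ Q x = 0 then 0 else P x ^ t * Q x ^ (1 - t))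

/-- The Chernoff information between `P` and `Q`. -/
noncomputable def chernoffInfo {α : Type*} [Fintype α] (P Q : PMF α) : EReal :=
  sSup (chernoffFun P Q '' Set.Icc 0 1)

/-- The larger of the two relative entropies `D(R ‖ P)`, `D(R ‖ Q)`, as an extended real. -/
noncomputable def maxRelEntropy {α : Type*} (P Q R : PMF α) : EReal :=
  ((max (relEntropy R P) (relEntropy R Q) : ℝ≥0∞) : EReal)

/-- `p n` has exponent `E` if `-(1/n) log (p n) → E`, where `E` may be infinite. -/
def HasExponent (p : ℕ → ℝ≥0∞) (E : EReal) : Prop :=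
  Tendsto (fun n : ℕ => -ENNReal.log (p n) / (n : EReal)) atTop (𝓝 E)

end MaximalCoupling

open MaximalCoupling

/-!
The maximal probability of `X = Y` over couplings of `P` and `Q` is the overlap
`∑ min (P x) (Q x) = 1 - tvDist P Q`: the diagonal of a coupling is bounded by both marginals, and
equality holds when the excess masses `P - min P Q` and `Q - min P Q`, whose supports are disjoint,
are coupled independently (`isGreatest_overlap`). For a product coupling the probability of equality
is a power, so its exponent is read off from a single letter.

For product distributions, `min a b ≤ a ^ t * b ^ (1 - t)` bounds the overlap of the `n`-fold powers
by `Z t ^ n`, where `Z t` is the Chernoff sum (`overlap_iid_le_pow`). Hence the exponent is at least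
the Chernoff information, and it is positive because `Z (1 / 2) < 1` for `P ≠ Q`. Conversely, let `R`
be absolutely continuous with respect to `P` and `Q`. Changing measure to `R ^ n` and applying
Jensen's inequality to the exponential bounds the overlap below by the exponential of
`-(n * max (D(R ‖ P)) (D(R ‖ Q)) + O(√n))` (`exists_exp_le_sum_min_prod`); the error term is
controlled by the variance of an i.i.d. sum, so that no counting of types is needed. So the Chernoff
information is at most `max (D(R ‖ P)) (D(R ‖ Q))` for every `R`, and the exponent lies in between.

The gap closes at one `R`. Let `t` minimise the smooth function `Z` on `[0, 1]`, and let `R` be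
proportional to `P ^ t * Q ^ (1 - t)` on the common support. Then
`D(R ‖ P) = -log (Z t) - (1 - t) * Z' t / Z t` and `D(R ‖ Q) = -log (Z t) + t * Z' t / Z t`, and the
first-order condition at the minimiser, valid also at the end points, makes both at most `-log (Z t)`
(`maxRelEntropy_tilted_le`). When the supports are disjoint, all the quantities are infinite.
-/

open Filter Topology
open scoped ENNReal

namespace MaximalCoupling

/-! ### The overlap of two distributions and maximal couplings -/

section Overlap

variable {α : Type*} [Fintype α]

/-- The common mass `∑ min (P x) (Q x)` of two distributions. -/
noncomputable def overlap (P Q : PMF α) : ℝ≥0∞ :=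
  ∑ x, min (P x) (Q x)

theorem sum_coe_eq_one (P : PMF α) : ∑ x, P x = 1 := by
  rw [← tsum_fintype (L := .unconditional α)]
  exact P.tsum_coe

theorem sum_toReal_eq_one (P : PMF α) : ∑ x, (P x).toReal = 1 := by
  rw [← ENNReal.toReal_sum fun x _ => P.apply_ne_top x, sum_coe_eq_one, ENNReal.toReal_one]

theorem overlap_le_one (P Q : PMF α) : overlap P Q ≤ 1 :=
  (Finset.sum_le_sum fun _ _ => min_le_left _ _).trans_eq (sum_coe_eq_one P)

theorem overlap_comm (P Q : PMF α) : overlap P Q = overlap Q P := by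
  simp [overlap, min_comm]

theorem sum_sub_min (P Q : PMF α) : ∑ x, (P x - min (P x) (Q x)) = 1 - overlap P Q := by
  refine ENNReal.eq_sub_of_add_eq (ne_top_of_le_ne_top ENNReal.one_ne_top (overlap_le_one P Q)) ?_
  rw [overlap, ← Finset.sum_add_distrib, ← sum_coe_eq_one P]
  exact Finset.sum_congr rfl fun x _ => tsub_add_cancel_of_le (min_le_left _ _)

theorem sub_min_mul_sub_min (a b : ℝ≥0∞) : (a - min a b) * (b - min a b) = 0 := by
  rcases le_total a b with h | h <;> simp [h]

theorem toReal_overlap (P Q : PMF α) :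
    (overlap P Q).toReal = ∑ x, min (P x).toReal (Q x).toReal := by
  rw [overlap, ENNReal.toReal_sum fun x _ =>
    ne_top_of_le_ne_top (P.apply_ne_top x) (min_le_left _ _)]
  exact Finset.sum_congr rfl fun x _ => ENNReal.toReal_min (P.apply_ne_top x) (Q.apply_ne_top x)

theorem overlap_eq_ofReal_one_sub_tvDist (P Q : PMF α) :
    overlap P Q = ENNReal.ofReal (1 - tvDist P Q) := by
  rw [← ENNReal.ofReal_toReal (ne_top_of_le_ne_top ENNReal.one_ne_top (overlap_le_one P Q)),
    toReal_overlap]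
  congr 1
  have h : ∀ a b : ℝ, min a b = (1 / 2) * a + (1 / 2) * b - (1 / 2) * |a - b| := by
    intro a b
    rcases le_total a b with h | h
    · rw [min_eq_left h, abs_of_nonpos (by linarith)]; ring
    · rw [min_eq_right h, abs_of_nonneg (by linarith)]; ring
  simp_rw [h, Finset.sum_sub_distrib, Finset.sum_add_distrib, ← Finset.mul_sum,
    sum_toReal_eq_one, tvDist]
  ring

theorem map_fst_apply {β : Type*} [Fintype β] (π : PMF (α × β)) (x : α) :
    π.map Prod.fst x = ∑ y, π (x, y) := by
  classical
  rw [PMF.map_apply, tsum_fintype, Fintype.sum_prod_type, Finset.sum_eq_single x]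
  · simp
  · intro b _ hb
    simp [hb.symm]
  · simp

theorem map_snd_apply {β : Type*} [Fintype β] (π : PMF (α × β)) (y : β) :
    π.map Prod.snd y = ∑ x, π (x, y) := by
  classical
  rw [PMF.map_apply, tsum_fintype, Fintype.sum_prod_type_right, Finset.sum_eq_single y]
  · simp
  · intro b _ hb
    simp [hb.symm]
  · simp

theorem eqProb_eq_sum (π : PMF (α × α)) : eqProb π = ∑ x, π (x, x) := by
  classical
  rw [eqProb, PMF.toOuterMeasure_apply_fintype, Fintype.sum_prod_type]
  refine Finset.sum_congr rfl fun x _ => ?_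
  rw [Finset.sum_eq_single x]
  · simp
  · intro b _ hb
    simp [hb.symm]
  · simp

theorem eqProb_le_overlap {P Q : PMF α} {π : PMF (α × α)} (hπ : π ∈ couplings P Q) :
    eqProb π ≤ overlap P Q := by
  rw [eqProb_eq_sum, overlap]
  refine Finset.sum_le_sum fun x _ => le_min ?_ ?_
  · rw [← hπ.1, map_fst_apply]
    exact Finset.single_le_sum (f := fun y => π (x, y)) (fun _ _ => zero_le) (Finset.mem_univ x)
  · rw [← hπ.2, map_snd_apply]
    exact Finset.single_le_sum (f := fun y => π (y, x)) (fun _ _ => zero_le) (Finset.mem_univ x)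

open Classical in
/-- Weights of the maximal coupling: the common mass sits on the diagonal, and the excess masses of
`P` and `Q` are coupled independently. For `P = Q` the denominator vanishes, but so do the
excess masses. -/
noncomputable def maximalWeight (P Q : PMF α) (z : α × α) : ℝ≥0∞ :=
  (if z.1 = z.2 then min (P z.1) (Q z.1) else 0) +
    (P z.1 - min (P z.1) (Q z.1)) * (Q z.2 - min (P z.2) (Q z.2)) / (1 - overlap P Q)

theorem excess_mul_div (P Q : PMF α) (x : α) :
    (P x - min (P x) (Q x)) * (1 - overlap P Q) / (1 - overlap P Q) =
      P x - min (P x) (Q x) := by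
  by_cases h : 1 - overlap P Q = 0
  · have := sum_sub_min P Q
    rw [h, Finset.sum_eq_zero_iff] at this
    rw [this x (Finset.mem_univ x), zero_mul, ENNReal.zero_div]
  · exact ENNReal.mul_div_cancel_right h (ne_top_of_le_ne_top ENNReal.one_ne_top tsub_le_self)

theorem sum_maximalWeight_right (P Q : PMF α) (x : α) :
    ∑ y, maximalWeight P Q (x, y) = P x := by
  have h : ∑ y, (Q y - min (P y) (Q y)) = 1 - overlap P Q := by
    simpa only [min_comm, overlap_comm] using sum_sub_min Q P
  have hsum : ∑ y, (P x - min (P x) (Q x)) * (Q y - min (P y) (Q y)) / (1 - overlap P Q) =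
      P x - min (P x) (Q x) := by
    simp only [div_eq_mul_inv]
    rw [← Finset.sum_mul, ← Finset.mul_sum, h, ← div_eq_mul_inv, excess_mul_div]
  simp only [maximalWeight, Finset.sum_add_distrib]
  classical
  rw [hsum, Finset.sum_ite_eq, if_pos (Finset.mem_univ _)]
  exact add_tsub_cancel_of_le (min_le_left _ _)

theorem sum_maximalWeight_left (P Q : PMF α) (y : α) :
    ∑ x, maximalWeight P Q (x, y) = Q y := by
  have h : (Q y - min (P y) (Q y)) * (1 - overlap P Q) / (1 - overlap P Q) =
      Q y - min (P y) (Q y) := by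
    simpa only [min_comm, overlap_comm] using excess_mul_div Q P y
  have hsum : ∑ x, (P x - min (P x) (Q x)) * (Q y - min (P y) (Q y)) / (1 - overlap P Q) =
      Q y - min (P y) (Q y) := by
    simp only [div_eq_mul_inv]
    rw [← Finset.sum_mul, ← Finset.sum_mul, sum_sub_min, mul_comm (1 - overlap P Q),
      ← div_eq_mul_inv, h]
  simp only [maximalWeight, Finset.sum_add_distrib]
  classical
  rw [hsum, Finset.sum_ite_eq', if_pos (Finset.mem_univ _)]
  exact add_tsub_cancel_of_le (min_le_right _ _)

/-- A coupling of `P` and `Q` attaining the maximal equality probability. -/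
noncomputable def maximalCoupling (P Q : PMF α) : PMF (α × α) :=
  PMF.ofFintype (maximalWeight P Q) (by
    simp_rw [Fintype.sum_prod_type, sum_maximalWeight_right, sum_coe_eq_one])

theorem maximalCoupling_mem_couplings (P Q : PMF α) : maximalCoupling P Q ∈ couplings P Q := by
  constructor
  · ext x
    simp_rw [map_fst_apply, maximalCoupling, PMF.ofFintype_apply, sum_maximalWeight_right]
  · ext x
    simp_rw [map_snd_apply, maximalCoupling, PMF.ofFintype_apply, sum_maximalWeight_left]

theorem eqProb_maximalCoupling (P Q : PMF α) : eqProb (maximalCoupling P Q) = overlap P Q := by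
  simp [eqProb_eq_sum, maximalCoupling, maximalWeight, overlap, sub_min_mul_sub_min]

theorem isGreatest_overlap (P Q : PMF α) :
    IsGreatest (eqProb '' couplings P Q) (overlap P Q) := by
  refine ⟨⟨_, maximalCoupling_mem_couplings P Q, eqProb_maximalCoupling P Q⟩, ?_⟩
  rintro _ ⟨π, hπ, rfl⟩
  exact eqProb_le_overlap hπ

theorem maxEqProb_eq_overlap (P Q : PMF α) : maxEqProb P Q = overlap P Q :=
  (isGreatest_overlap P Q).csSup_eq

end Overlap

/-! ### Product couplings -/

section Product

variable {α : Type*} [Fintype α]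

theorem iid_apply (P : PMF α) (n : ℕ) (x : Fin n → α) : iid P n x = ∏ i, P (x i) := rfl

theorem map_iid {β : Type*} [Fintype β] (π : PMF α) (f : α → β) (n : ℕ) :
    (iid π n).map (fun z i => f (z i)) = iid (π.map f) n := by
  classical
  ext x
  simp_rw [iid_apply, PMF.map_apply, tsum_fintype, Finset.prod_univ_sum, Fintype.piFinset_univ,
    funext_iff, iid_apply, Finset.prod_ite_zero, Finset.mem_univ, true_imp_iff]

theorem prodCoupling_mem_couplings {P Q : PMF α} {π : PMF (α × α)} (hπ : π ∈ couplings P Q)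
    (n : ℕ) : prodCoupling π n ∈ couplings (iid P n) (iid Q n) := by
  constructor
  · rw [prodCoupling, PMF.map_comp, ← hπ.1, ← map_iid]
    rfl
  · rw [prodCoupling, PMF.map_comp, ← hπ.2, ← map_iid]
    rfl

theorem prodCoupling_apply (π : PMF (α × α)) (n : ℕ) (x y : Fin n → α) :
    prodCoupling π n (x, y) = ∏ i, π (x i, y i) := by
  classical
  rw [prodCoupling, PMF.map_apply, tsum_fintype, Finset.sum_eq_single fun i => (x i, y i)]
  · simp [iid_apply]
  · intro z _ hz
    refine if_neg fun h => hz ?_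
    simp only [Prod.mk.injEq] at h
    rw [h.1, h.2]
  · simp

theorem eqProb_prodCoupling (π : PMF (α × α)) (n : ℕ) :
    eqProb (prodCoupling π n) = eqProb π ^ n := by
  simp_rw [eqProb_eq_sum, prodCoupling_apply, Fintype.sum_pow]

theorem neg_log_pow_div (p : ℝ≥0∞) {n : ℕ} (hn : n ≠ 0) :
    -ENNReal.log (p ^ n) / (n : EReal) = -ENNReal.log p := by
  have h0 : (n : EReal) ≠ 0 := by exact_mod_cast hn
  rw [ENNReal.log_pow, ← mul_neg, ← EReal.mul_div, EReal.mul_div_cancel (EReal.natCast_ne_bot n)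
    (EReal.natCast_ne_top n) h0]

theorem hasExponent_pow (p : ℝ≥0∞) : HasExponent (fun n => p ^ n) (-ENNReal.log p) := by
  refine tendsto_const_nhds.congr' ?_
  filter_upwards [eventually_ne_atTop 0] with n hn
  exact (neg_log_pow_div p hn).symm

theorem hasExponent_eqProb_prodCoupling (π : PMF (α × α)) :
    HasExponent (fun n => eqProb (prodCoupling π n)) (-ENNReal.log (eqProb π)) := by
  simp_rw [eqProb_prodCoupling]
  exact hasExponent_pow _

end Product

/-! ### The Chernoff bound -/

section Chernoff

variable {α : Type*} [Fintype α]

/-- The sum `∑ P x ^ t * Q x ^ (1 - t)` over the common support of `P` and `Q`. -/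
noncomputable def chernoffSum (P Q : PMF α) (t : ℝ) : ℝ≥0∞ :=
  ∑ x, if P x = 0 ∨ Q x = 0 then 0 else P x ^ t * Q x ^ (1 - t)

theorem chernoffFun_eq (P Q : PMF α) (t : ℝ) :
    chernoffFun P Q t = -ENNReal.log (chernoffSum P Q t) := rfl

theorem min_le_rpow_mul_rpow {a b : ℝ≥0∞} (ha : a ≠ 0) (ha' : a ≠ ⊤) (hb : b ≠ 0)
    {t : ℝ} (ht : t ∈ Set.Icc (0 : ℝ) 1) : min a b ≤ a ^ t * b ^ (1 - t) := by
  have h0 : min a b ≠ 0 := by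
    rcases le_total a b with h | h <;> simp [h, ha, hb]
  have h1 : min a b ≠ ⊤ := ne_top_of_le_ne_top ha' (min_le_left _ _)
  calc min a b = min a b ^ t * min a b ^ (1 - t) := by
        rw [← ENNReal.rpow_add _ _ h0 h1, add_sub_cancel, ENNReal.rpow_one]
    _ ≤ a ^ t * b ^ (1 - t) := by
        gcongr
        · exact ht.1
        · exact min_le_left _ _
        · linarith [ht.2]
        · exact min_le_right _ _

theorem overlap_le_chernoffSum (P Q : PMF α) {t : ℝ} (ht : t ∈ Set.Icc (0 : ℝ) 1) :
    overlap P Q ≤ chernoffSum P Q t := by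
  refine Finset.sum_le_sum fun x _ => ?_
  split_ifs with h
  · rcases h with h | h <;> simp [h]
  · push Not at h
    exact min_le_rpow_mul_rpow h.1 (P.apply_ne_top x) h.2 ht

theorem chernoffSum_iid (P Q : PMF α) (t : ℝ) (n : ℕ) :
    chernoffSum (iid P n) (iid Q n) t = chernoffSum P Q t ^ n := by
  rw [chernoffSum, chernoffSum, Fintype.sum_pow]
  refine Finset.sum_congr rfl fun x _ => ?_
  simp_rw [iid_apply, Finset.prod_eq_zero_iff, Finset.mem_univ, true_and]
  by_cases h : ∃ i, P (x i) = 0 ∨ Q (x i) = 0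
  · rw [if_pos (exists_or.1 h)]
    obtain ⟨i, hi⟩ := h
    exact (Finset.prod_eq_zero (f := fun j => if P (x j) = 0 ∨ Q (x j) = 0 then 0 else
      P (x j) ^ t * Q (x j) ^ (1 - t)) (Finset.mem_univ i) (if_pos hi)).symm
  · rw [if_neg (fun h' => h (exists_or.2 h'))]
    push Not at h
    rw [Finset.prod_congr rfl fun i _ => if_neg (not_or.2 (h i)), Finset.prod_mul_distrib,
      ENNReal.prod_rpow_of_ne_top fun i _ => P.apply_ne_top _,
      ENNReal.prod_rpow_of_ne_top fun i _ => Q.apply_ne_top _]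

theorem overlap_iid_le_pow (P Q : PMF α) {t : ℝ} (ht : t ∈ Set.Icc (0 : ℝ) 1) (n : ℕ) :
    overlap (iid P n) (iid Q n) ≤ chernoffSum P Q t ^ n :=
  (overlap_le_chernoffSum _ _ ht).trans_eq (chernoffSum_iid P Q t n)

theorem chernoffInfo_le_neg_log_overlap (P Q : PMF α) :
    chernoffInfo P Q ≤ -ENNReal.log (overlap P Q) := by
  refine sSup_le ?_
  rintro _ ⟨t, ht, rfl⟩
  exact EReal.neg_le_neg_iff.2 (ENNReal.log_le_log (overlap_le_chernoffSum P Q ht))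

theorem chernoffInfo_le_exponent (P Q : PMF α) {n : ℕ} (hn : n ≠ 0) :
    chernoffInfo P Q ≤ -ENNReal.log (overlap (iid P n) (iid Q n)) / (n : EReal) := by
  refine sSup_le ?_
  rintro _ ⟨t, ht, rfl⟩
  rw [chernoffFun_eq, ← neg_log_pow_div _ hn]
  exact EReal.div_le_div_right_of_nonneg (by positivity)
    (EReal.neg_le_neg_iff.2 (ENNReal.log_le_log (overlap_iid_le_pow P Q ht n)))

/-- The Bhattacharyya coefficient of distinct distributions is less than one, because
`1 - ∑ √(P x Q x) = (1/2) ∑ (√(P x) - √(Q x))²`. -/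
theorem chernoffSum_half_lt_one {P Q : PMF α} (hPQ : P ≠ Q) : chernoffSum P Q (1 / 2) < 1 := by
  obtain ⟨x₀, hx₀⟩ : ∃ x, P x ≠ Q x := by
    by_contra! h
    exact hPQ (PMF.ext h)
  have hterm : ∀ x, (if P x = 0 ∨ Q x = 0 then 0 else P x ^ (1 / 2 : ℝ) * Q x ^ (1 - 1 / 2 : ℝ)) =
      ENNReal.ofReal (√(P x).toReal * √(Q x).toReal) := by
    intro x
    rw [ENNReal.ofReal_mul (by positivity), Real.sqrt_eq_rpow, Real.sqrt_eq_rpow,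
      ← ENNReal.ofReal_rpow_of_nonneg (by positivity) (by norm_num),
      ← ENNReal.ofReal_rpow_of_nonneg (by positivity) (by norm_num),
      ENNReal.ofReal_toReal (P.apply_ne_top x), ENNReal.ofReal_toReal (Q.apply_ne_top x)]
    split_ifs with h
    · rcases h with h | h <;> simp [h]
    · norm_num
  rw [chernoffSum, Finset.sum_congr rfl fun x _ => hterm x,
    ← ENNReal.ofReal_sum_of_nonneg fun x _ => by positivity, ENNReal.ofReal_lt_one]
  have hpos : 0 < ∑ x, (√(P x).toReal - √(Q x).toReal) ^ 2 := by
    refine Finset.sum_pos' (fun x _ => sq_nonneg _) ⟨x₀, Finset.mem_univ _, ?_⟩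
    refine sq_pos_iff.2 fun h => hx₀ ?_
    refine (ENNReal.toReal_eq_toReal_iff' (P.apply_ne_top _) (Q.apply_ne_top _)).1 ?_
    exact (Real.sqrt_inj ENNReal.toReal_nonneg ENNReal.toReal_nonneg).1 (sub_eq_zero.1 h)
  have hsq : ∀ x, (√(P x).toReal - √(Q x).toReal) ^ 2 =
      (P x).toReal + (Q x).toReal - 2 * (√(P x).toReal * √(Q x).toReal) := by
    intro x
    rw [sub_sq, Real.sq_sqrt (by positivity), Real.sq_sqrt (by positivity)]
    ring
  simp_rw [hsq, Finset.sum_sub_distrib, Finset.sum_add_distrib, ← Finset.mul_sum,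
    sum_toReal_eq_one] at hpos
  linarith

/-- Replacing the Bhattacharyya coefficient by its maximum with `1/2` gives a rate that is finite
also for distributions with disjoint supports. -/
theorem exists_overlap_iid_le_exp {P Q : PMF α} (hPQ : P ≠ Q) :
    ∃ c : ℝ, 0 < c ∧ ∃ C : ℝ, ∀ n : ℕ,
      overlap (iid P n) (iid Q n) ≤ ENNReal.ofReal (C * Real.exp (-(c * n))) := by
  have hlt := chernoffSum_half_lt_one hPQ
  have hz : chernoffSum P Q (1 / 2) ≠ ⊤ := (hlt.trans ENNReal.one_lt_top).ne
  set z := max (chernoffSum P Q (1 / 2)).toReal (1 / 2) with hzdef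
  have hz0 : 0 < z := lt_max_of_lt_right (by norm_num)
  have hz1 : z < 1 := by
    refine max_lt ?_ (by norm_num)
    rw [← ENNReal.toReal_one]
    exact (ENNReal.toReal_lt_toReal hz ENNReal.one_ne_top).2 hlt
  refine ⟨-Real.log z, neg_pos.2 (Real.log_neg hz0 hz1), 1, fun n => ?_⟩
  refine (overlap_iid_le_pow P Q (t := 1 / 2) (by norm_num) n).trans ?_
  have hexp : Real.exp (-(-Real.log z * n)) = z ^ n := by
    rw [neg_mul, neg_neg, mul_comm, Real.exp_nat_mul, Real.exp_log hz0]
  rw [one_mul, hexp, ENNReal.ofReal_pow hz0.le]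
  gcongr
  exact ENNReal.le_ofReal_iff_toReal_le hz hz0.le |>.2 (le_max_left _ _)

end Chernoff

/-! ### Relative entropy on a finite alphabet -/

section RelEntropy

variable {α : Type*} [Fintype α]

theorem relEntropy_eq_top {R P : PMF α} {x : α} (hP : P x = 0) (hR : R x ≠ 0) :
    relEntropy R P = ⊤ := by
  let _ : MeasurableSpace α := ⊤
  refine InformationTheory.klDiv_of_not_ac fun h => hR ?_
  have := @h {x} (by rw [P.toMeasure_apply_singleton x (measurableSet_singleton x), hP])
  rwa [R.toMeasure_apply_singleton x (measurableSet_singleton x)] at this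

theorem relEntropy_eq_sum {R P : PMF α} (h : ∀ x, R x ≠ 0 → P x ≠ 0) :
    relEntropy R P ≠ ⊤ ∧ (relEntropy R P).toReal =
      ∑ x, (R x).toReal * Real.log ((R x).toReal / (P x).toReal) := by
  let _ : MeasurableSpace α := ⊤
  have hac : R.toMeasure.AbsolutelyContinuous P.toMeasure := by
    intro s hs
    rw [PMF.toMeasure_apply_fintype, Finset.sum_eq_zero_iff] at hs ⊢
    intro x hx
    have := hs x hx
    by_cases hxs : x ∈ s
    · rw [Set.indicator_of_mem hxs] at this ⊢
      by_contra hR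
      exact h x hR this
    · exact Set.indicator_of_notMem hxs _
  refine ⟨InformationTheory.klDiv_ne_top hac .of_finite, ?_⟩
  rw [relEntropy, InformationTheory.toReal_klDiv_of_measure_eq hac (by simp),
    PMF.integral_eq_sum]
  refine Finset.sum_congr rfl fun x _ => ?_
  by_cases hR : R x = 0
  · simp [hR]
  have hd : R.toMeasure.rnDeriv P.toMeasure x * P x = R x := by
    have := congrArg (fun μ => μ {x}) (MeasureTheory.Measure.withDensity_rnDeriv_eq _ _ hac)
    simpa only [MeasureTheory.withDensity_apply _ (measurableSet_singleton x),
      MeasureTheory.lintegral_singleton,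
      PMF.toMeasure_apply_singleton _ x (measurableSet_singleton x)] using this
  have hp : (P x).toReal ≠ 0 := ENNReal.toReal_ne_zero.2 ⟨h x hR, P.apply_ne_top x⟩
  rw [MeasureTheory.llr, ← hd, ENNReal.toReal_mul, mul_div_cancel_right₀ _ hp, smul_eq_mul]

end RelEntropy

/-! ### A lower bound on the overlap of product distributions -/

section LowerBound

variable {α : Type*} [Fintype α]

theorem sum_fin_succ_fun {M : Type*} [AddCommMonoid M] {n : ℕ} (G : (Fin (n + 1) → α) → M) :
    ∑ x, G x = ∑ a, ∑ y : Fin n → α, G (Fin.cons a y) := by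
  rw [← (Fin.consEquiv fun _ => α).sum_comp, Fintype.sum_prod_type]
  rfl

/-- The variance of a sum of `n` i.i.d. centred variables is `n` times their common variance. -/
theorem sum_prod_mul_sum_sq {w f : α → ℝ} (hw : ∑ a, w a = 1) (hf : ∑ a, w a * f a = 0) (n : ℕ) :
    ∑ x : Fin n → α, (∏ i, w (x i)) * (∑ i, f (x i)) ^ 2 = n * ∑ a, w a * f a ^ 2 := by
  induction n with
  | zero => simp
  | succ n ih =>
    have hprod : ∑ x : Fin n → α, ∏ i, w (x i) = 1 := by
      rw [← Fintype.sum_pow, hw, one_pow]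
    -- Splitting off the first coordinate, the cross term vanishes because `f` is centred.
    have hexp : ∀ (a : α) (y : Fin n → α),
        (w a * ∏ i, w (y i)) * (f a + ∑ i, f (y i)) ^ 2 =
          w a * f a ^ 2 * (∏ i, w (y i)) + w a * f a * (2 * ((∏ i, w (y i)) * ∑ i, f (y i))) +
            w a * ((∏ i, w (y i)) * (∑ i, f (y i)) ^ 2) := by
      intro a y
      ring
    simp_rw [sum_fin_succ_fun, Fin.prod_univ_succ, Fin.sum_univ_succ, Fin.cons_zero, Fin.cons_succ,
      hexp, Finset.sum_add_distrib, ← Finset.mul_sum, ← Finset.sum_mul, ih, hprod, hf, hw]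
    push_cast
    ring

/-- Deviations of i.i.d. sums are of order `√n`. The bound `|s| ≤ (s² / √n + √n) / 2` reduces the
first absolute moment to the variance. -/
theorem sum_prod_mul_abs_sum_le {w f : α → ℝ} (hw0 : ∀ a, 0 ≤ w a) (hw : ∑ a, w a = 1)
    (hf : ∑ a, w a * f a = 0) {n : ℕ} (hn : n ≠ 0) :
    ∑ x : Fin n → α, (∏ i, w (x i)) * |∑ i, f (x i)| ≤
      ((∑ a, w a * f a ^ 2) + 1) / 2 * √n := by
  have hs : 0 < √(n : ℝ) := Real.sqrt_pos.2 (by positivity)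
  have habs : ∀ s : ℝ, |s| ≤ s ^ 2 * (1 / (2 * √n)) + √n / 2 := by
    intro s
    have h : s ^ 2 * (1 / (2 * √n)) + √n / 2 - |s| = (|s| - √n) ^ 2 / (2 * √n) := by
      rw [← sq_abs s]
      field_simp
      ring
    have : 0 ≤ (|s| - √n) ^ 2 / (2 * √n) := by positivity
    linarith
  calc ∑ x : Fin n → α, (∏ i, w (x i)) * |∑ i, f (x i)|
      ≤ ∑ x : Fin n → α, (∏ i, w (x i)) *
          ((∑ i, f (x i)) ^ 2 * (1 / (2 * √n)) + √n / 2) :=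
        Finset.sum_le_sum fun x _ =>
          mul_le_mul_of_nonneg_left (habs _) (Finset.prod_nonneg fun i _ => hw0 _)
    _ = (∑ a, w a * f a ^ 2 + 1) / 2 * √n := by
        simp_rw [mul_add, ← mul_assoc, Finset.sum_add_distrib, ← Finset.sum_mul,
          sum_prod_mul_sum_sq hw hf, ← Fintype.sum_pow, hw]
        rw [show n * (∑ a, w a * f a ^ 2) * (1 / (2 * √(n : ℝ))) =
          (∑ a, w a * f a ^ 2) / 2 * (n / √n) by ring, Real.div_sqrt]
        ring

/-- Change of measure: under the `n`-fold power of `r` the log-likelihood ratios with respect to `p`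
and `q` are sums with means `n * ∑ r * log (r / p)` and `n * ∑ r * log (r / q)`. Jensen's inequality
for the exponential bounds the overlap below by the exponential of minus the mean of their maximum,
which exceeds the larger mean by at most a multiple of `√n`. -/
theorem exists_exp_le_sum_min_prod {r p q : α → ℝ} (hr0 : ∀ a, 0 ≤ r a) (hr : ∑ a, r a = 1)
    (hp0 : ∀ a, 0 ≤ p a) (hq0 : ∀ a, 0 ≤ q a)
    (hrp : ∀ a, r a ≠ 0 → p a ≠ 0) (hrq : ∀ a, r a ≠ 0 → q a ≠ 0) :
    ∃ c : ℝ, ∀ n : ℕ, n ≠ 0 →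
      Real.exp (-(n * max (∑ a, r a * Real.log (r a / p a)) (∑ a, r a * Real.log (r a / q a)) +
        c * √n)) ≤ ∑ x : Fin n → α, min (∏ i, p (x i)) (∏ i, q (x i)) := by
  set A : α → ℝ := fun a => Real.log (r a / p a) with hA
  set B : α → ℝ := fun a => Real.log (r a / q a) with hB
  set DA := ∑ a, r a * A a with hDA
  set DB := ∑ a, r a * B a with hDB
  have hcA : ∑ a, r a * (A a - DA) = 0 := by
    simp_rw [mul_sub, Finset.sum_sub_distrib, ← Finset.sum_mul, hr, hDA]
    ring
  have hcB : ∑ a, r a * (B a - DB) = 0 := by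
    simp_rw [mul_sub, Finset.sum_sub_distrib, ← Finset.sum_mul, hr, hDB]
    ring
  refine ⟨(∑ a, r a * (A a - DA) ^ 2 + 1) / 2 + (∑ a, r a * (B a - DB) ^ 2 + 1) / 2,
    fun n hn => ?_⟩
  have hprod : ∑ x : Fin n → α, ∏ i, r (x i) = 1 := by
    rw [← Fintype.sum_pow, hr, one_pow]
  have hprod0 : ∀ x : Fin n → α, 0 ≤ ∏ i, r (x i) := fun x => Finset.prod_nonneg fun i _ => hr0 _
  have hlog : ∀ s : α → ℝ, (∀ a, 0 ≤ s a) → (∀ a, r a ≠ 0 → s a ≠ 0) →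
      ∀ x : Fin n → α, (∀ i, r (x i) ≠ 0) →
        (∏ i, r (x i)) * Real.exp (-∑ i, Real.log (r (x i) / s (x i))) = ∏ i, s (x i) := by
    intro s hs0 hrs x hx
    rw [← Finset.sum_neg_distrib, Real.exp_sum, ← Finset.prod_mul_distrib]
    refine Finset.prod_congr rfl fun i _ => ?_
    have h1 : 0 < r (x i) := (hr0 _).lt_of_ne' (hx i)
    have h2 : 0 < s (x i) := (hs0 _).lt_of_ne' (hrs _ (hx i))
    rw [Real.exp_neg, Real.exp_log (by positivity)]
    field_simp
  -- The maximum of the two sums is compared with the larger mean, at the cost of both deviations.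
  have hmax : ∀ x : Fin n → α, max (∑ i, A (x i)) (∑ i, B (x i)) ≤
      n * max DA DB + |∑ i, (A (x i) - DA)| + |∑ i, (B (x i) - DB)| := by
    intro x
    have h1 : ∑ i, (A (x i) - DA) = ∑ i, A (x i) - n * DA := by simp
    have h2 : ∑ i, (B (x i) - DB) = ∑ i, B (x i) - n * DB := by simp
    have h3 : n * DA ≤ n * max DA DB := by gcongr; exact le_max_left _ _
    have h4 : n * DB ≤ n * max DA DB := by gcongr; exact le_max_right _ _
    have h5 := le_abs_self (∑ i, (A (x i) - DA))
    have h6 := le_abs_self (∑ i, (B (x i) - DB))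
    have h7 := abs_nonneg (∑ i, (A (x i) - DA))
    have h8 := abs_nonneg (∑ i, (B (x i) - DB))
    refine max_le ?_ ?_ <;> linarith
  have hmean : ∑ x : Fin n → α, (∏ i, r (x i)) * max (∑ i, A (x i)) (∑ i, B (x i)) ≤
      n * max DA DB + ((∑ a, r a * (A a - DA) ^ 2 + 1) / 2 +
        (∑ a, r a * (B a - DB) ^ 2 + 1) / 2) * √n := by
    calc _ ≤ ∑ x : Fin n → α, (∏ i, r (x i)) *
          (n * max DA DB + |∑ i, (A (x i) - DA)| + |∑ i, (B (x i) - DB)|) :=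
          Finset.sum_le_sum fun x _ => mul_le_mul_of_nonneg_left (hmax x) (hprod0 x)
      _ = n * max DA DB + ∑ x : Fin n → α, (∏ i, r (x i)) * |∑ i, (A (x i) - DA)| +
          ∑ x : Fin n → α, (∏ i, r (x i)) * |∑ i, (B (x i) - DB)| := by
          simp_rw [mul_add, Finset.sum_add_distrib, ← Finset.sum_mul, hprod, one_mul]
      _ ≤ _ := by
          have h1 := sum_prod_mul_abs_sum_le hr0 hr hcA hn
          have h2 := sum_prod_mul_abs_sum_le hr0 hr hcB hn
          rw [add_mul]
          linarith
  calc _ ≤ Real.exp (∑ x : Fin n → α,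
        (∏ i, r (x i)) • -max (∑ i, A (x i)) (∑ i, B (x i))) := by
        simp_rw [smul_eq_mul, mul_neg, Finset.sum_neg_distrib]
        exact Real.exp_le_exp.2 (neg_le_neg hmean)
    _ ≤ ∑ x : Fin n → α, (∏ i, r (x i)) • Real.exp (-max (∑ i, A (x i)) (∑ i, B (x i))) :=
        convexOn_exp.map_sum_le (fun x _ => hprod0 x) hprod fun _ _ => Set.mem_univ _
    _ ≤ _ := by
        refine Finset.sum_le_sum fun x _ => ?_
        rw [smul_eq_mul]
        by_cases hx : ∀ i, r (x i) ≠ 0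
        · refine le_min ?_ ?_
          · rw [← hlog p hp0 hrp x hx]
            gcongr
            · exact hprod0 x
            · exact le_max_left _ _
          · rw [← hlog q hq0 hrq x hx]
            gcongr
            · exact hprod0 x
            · exact le_max_right _ _
        · push Not at hx
          obtain ⟨i, hi⟩ := hx
          rw [Finset.prod_eq_zero (Finset.mem_univ i) hi, zero_mul]
          exact le_min (Finset.prod_nonneg fun i _ => hp0 _) (Finset.prod_nonneg fun i _ => hq0 _)

theorem exists_exponent_le {P Q R : PMF α} (hRP : ∀ x, R x ≠ 0 → P x ≠ 0)
    (hRQ : ∀ x, R x ≠ 0 → Q x ≠ 0) :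
    ∃ c : ℝ, ∀ n : ℕ, n ≠ 0 → -ENNReal.log (overlap (iid P n) (iid Q n)) / (n : EReal) ≤
      ((max (∑ x, (R x).toReal * Real.log ((R x).toReal / (P x).toReal))
        (∑ x, (R x).toReal * Real.log ((R x).toReal / (Q x).toReal)) + c / √n : ℝ) : EReal) := by
  have hne : ∀ {S T : PMF α}, (∀ x, S x ≠ 0 → T x ≠ 0) →
      ∀ x, (S x).toReal ≠ 0 → (T x).toReal ≠ 0 := fun h x hx =>
    ENNReal.toReal_ne_zero.2 ⟨h x (ENNReal.toReal_ne_zero.1 hx).1, PMF.apply_ne_top _ x⟩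
  obtain ⟨c, hc⟩ := exists_exp_le_sum_min_prod (fun x => ENNReal.toReal_nonneg)
    (sum_toReal_eq_one R) (fun x => ENNReal.toReal_nonneg) (fun x => ENNReal.toReal_nonneg)
    (hne hRP) (hne hRQ)
  refine ⟨c, fun n hn => ?_⟩
  have h := hc n hn
  set m := max (∑ x, (R x).toReal * Real.log ((R x).toReal / (P x).toReal))
        (∑ x, (R x).toReal * Real.log ((R x).toReal / (Q x).toReal))
  have hn0 : (0 : ℝ) < n := by positivity
  have hover : ENNReal.ofReal (Real.exp (-(n * m + c * √n))) ≤
      overlap (iid P n) (iid Q n) := by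
    refine (ENNReal.ofReal_le_iff_le_toReal
      (ne_top_of_le_ne_top ENNReal.one_ne_top (overlap_le_one _ _))).2 ?_
    rw [toReal_overlap]
    simpa only [iid_apply, ENNReal.toReal_prod] using h
  rw [EReal.div_le_iff_le_mul (by exact_mod_cast hn0) (EReal.natCast_ne_top n),
    EReal.neg_le]
  refine le_trans (le_of_eq ?_) (ENNReal.log_le_log hover)
  rw [ENNReal.log_ofReal_of_pos (Real.exp_pos _), Real.log_exp]
  have : (n : EReal) = ((n : ℝ) : EReal) := rfl
  rw [this, ← EReal.coe_mul, ← EReal.coe_neg]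
  congr 2
  rw [mul_add, mul_div_left_comm, Real.div_sqrt]

theorem tendsto_add_div_sqrt (m c : ℝ) :
    Tendsto (fun n : ℕ => ((m + c / √n : ℝ) : EReal)) atTop (𝓝 (m : EReal)) := by
  refine (continuous_coe_real_ereal.tendsto _).comp ?_
  have h : Tendsto (fun n : ℕ => √(n : ℝ)) atTop atTop :=
    Real.tendsto_sqrt_atTop.comp tendsto_natCast_atTop_atTop
  simpa using tendsto_const_nhds.add (tendsto_const_nhds.div_atTop h)

theorem maxRelEntropy_eq_sum {P Q R : PMF α} (hRP : ∀ x, R x ≠ 0 → P x ≠ 0)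
    (hRQ : ∀ x, R x ≠ 0 → Q x ≠ 0) :
    maxRelEntropy P Q R =
      ((max (∑ x, (R x).toReal * Real.log ((R x).toReal / (P x).toReal))
        (∑ x, (R x).toReal * Real.log ((R x).toReal / (Q x).toReal)) : ℝ) : EReal) := by
  obtain ⟨h1, h1'⟩ := relEntropy_eq_sum hRP
  obtain ⟨h2, h2'⟩ := relEntropy_eq_sum hRQ
  rw [maxRelEntropy, ← h1', ← h2', ← ENNReal.toReal_max h1 h2, EReal.coe_ennreal_toReal]
  exact (max_lt h1.lt_top h2.lt_top).ne

/-- If `R` is absolutely continuous with respect to `P` and `Q`, the lower and the upper bound on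
the exponent of the overlap are compared as `n → ∞`; otherwise the right side is infinite. -/
theorem chernoffInfo_le_maxRelEntropy (P Q R : PMF α) :
    chernoffInfo P Q ≤ maxRelEntropy P Q R := by
  by_cases h : ∀ x, R x ≠ 0 → P x ≠ 0 ∧ Q x ≠ 0
  · have hRP := fun x hx => (h x hx).1
    have hRQ := fun x hx => (h x hx).2
    obtain ⟨c, hc⟩ := exists_exponent_le hRP hRQ
    rw [maxRelEntropy_eq_sum hRP hRQ]
    refine ge_of_tendsto (tendsto_add_div_sqrt _ c) ?_
    filter_upwards [eventually_ne_atTop 0] with n hn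
    exact (chernoffInfo_le_exponent P Q hn).trans (hc n hn)
  · push Not at h
    obtain ⟨x, hR, hx⟩ := h
    suffices maxRelEntropy P Q R = ⊤ from this ▸ le_top
    rw [maxRelEntropy]
    by_cases hP : P x = 0
    · rw [relEntropy_eq_top hP hR]
      simp
    · rw [relEntropy_eq_top (hx hP) hR]
      simp

/-- A distribution whose larger relative entropy does not exceed the Chernoff information forces the
exponent of the overlap to be the Chernoff information. -/
theorem hasExponent_overlap_of_maxRelEntropy_le {P Q R : PMF α} (hRP : ∀ x, R x ≠ 0 → P x ≠ 0)
    (hRQ : ∀ x, R x ≠ 0 → Q x ≠ 0) (hR : maxRelEntropy P Q R ≤ chernoffInfo P Q) :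
    HasExponent (fun n => overlap (iid P n) (iid Q n)) (chernoffInfo P Q) := by
  obtain ⟨c, hc⟩ := exists_exponent_le hRP hRQ
  refine tendsto_of_tendsto_of_tendsto_of_le_of_le' tendsto_const_nhds
    (?_ : Tendsto _ atTop _) ?_ ((eventually_ne_atTop 0).mono hc)
  · rw [← (chernoffInfo_le_maxRelEntropy P Q R).antisymm' hR, maxRelEntropy_eq_sum hRP hRQ]
    exact tendsto_add_div_sqrt _ c
  · filter_upwards [eventually_ne_atTop 0] with n hn
    exact chernoffInfo_le_exponent P Q hn

end LowerBound

/-! ### The optimal tilted distribution -/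

section Tilting

variable {α : Type*}

open Classical in
/-- The summand `P x ^ t * Q x ^ (1 - t)` of the Chernoff sum as a real number, zero outside the
common support. -/
noncomputable def chernoffWeight (P Q : PMF α) (t : ℝ) (x : α) : ℝ :=
  if P x = 0 ∨ Q x = 0 then 0 else (P x).toReal ^ t * (Q x).toReal ^ (1 - t)

theorem chernoffWeight_nonneg (P Q : PMF α) (t : ℝ) (x : α) : 0 ≤ chernoffWeight P Q t x := by
  unfold chernoffWeight
  split_ifs <;> positivity

theorem chernoffWeight_pos {P Q : PMF α} {x : α} (hP : P x ≠ 0) (hQ : Q x ≠ 0) (t : ℝ) :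
    0 < chernoffWeight P Q t x := by
  have hp : 0 < (P x).toReal := ENNReal.toReal_pos hP (P.apply_ne_top x)
  have hq : 0 < (Q x).toReal := ENNReal.toReal_pos hQ (Q.apply_ne_top x)
  rw [chernoffWeight, if_neg (not_or.2 ⟨hP, hQ⟩)]
  positivity

theorem ne_zero_of_chernoffWeight_ne_zero {P Q : PMF α} {t : ℝ} {x : α}
    (h : chernoffWeight P Q t x ≠ 0) : P x ≠ 0 ∧ Q x ≠ 0 := by
  contrapose! h
  exact if_pos (or_iff_not_imp_left.2 h)

theorem hasDerivAt_chernoffWeight (P Q : PMF α) (x : α) (t : ℝ) :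
    HasDerivAt (fun s => chernoffWeight P Q s x)
      (chernoffWeight P Q t x * (Real.log (P x).toReal - Real.log (Q x).toReal)) t := by
  unfold chernoffWeight
  split_ifs with h
  · simpa using hasDerivAt_const t (0 : ℝ)
  · push Not at h
    have hp := (hasDerivAt_id t).const_rpow (ENNReal.toReal_pos h.1 (P.apply_ne_top x))
    have hq := ((hasDerivAt_id t).const_sub 1).const_rpow
      (ENNReal.toReal_pos h.2 (Q.apply_ne_top x))
    refine (hp.fun_mul hq).congr_deriv ?_
    simp only [id]
    ring

variable [Fintype α]

theorem sum_chernoffWeight_pos {P Q : PMF α} (h : ∃ x, P x ≠ 0 ∧ Q x ≠ 0) (t : ℝ) :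
    0 < ∑ x, chernoffWeight P Q t x := by
  obtain ⟨x, hP, hQ⟩ := h
  exact Finset.sum_pos' (fun x _ => chernoffWeight_nonneg P Q t x)
    ⟨x, Finset.mem_univ x, chernoffWeight_pos hP hQ t⟩

theorem chernoffSum_eq_ofReal (P Q : PMF α) (t : ℝ) :
    chernoffSum P Q t = ENNReal.ofReal (∑ x, chernoffWeight P Q t x) := by
  rw [ENNReal.ofReal_sum_of_nonneg fun x _ => chernoffWeight_nonneg P Q t x]
  refine Finset.sum_congr rfl fun x _ => ?_
  unfold chernoffWeight
  split_ifs with h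
  · simp
  · push Not at h
    rw [ENNReal.ofReal_mul (by positivity),
      ← ENNReal.ofReal_rpow_of_pos (ENNReal.toReal_pos h.1 (P.apply_ne_top x)),
      ← ENNReal.ofReal_rpow_of_pos (ENNReal.toReal_pos h.2 (Q.apply_ne_top x)),
      ENNReal.ofReal_toReal (P.apply_ne_top x), ENNReal.ofReal_toReal (Q.apply_ne_top x)]

theorem chernoffFun_eq_neg_log {P Q : PMF α} (h : ∃ x, P x ≠ 0 ∧ Q x ≠ 0) (t : ℝ) :
    chernoffFun P Q t = ((-Real.log (∑ x, chernoffWeight P Q t x) : ℝ) : EReal) := by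
  rw [chernoffFun_eq, chernoffSum_eq_ofReal,
    ENNReal.log_ofReal_of_pos (sum_chernoffWeight_pos h t), EReal.coe_neg]

theorem chernoffFun_eq_top {P Q : PMF α} (h : ∀ x, P x ≠ 0 → Q x = 0) (t : ℝ) :
    chernoffFun P Q t = ⊤ := by
  have h0 : chernoffSum P Q t = 0 :=
    Finset.sum_eq_zero fun x _ => if_pos (or_iff_not_imp_left.2 (h x))
  rw [chernoffFun_eq, h0, ENNReal.log_zero, EReal.neg_bot]

theorem hasDerivAt_sum_chernoffWeight (P Q : PMF α) (t : ℝ) :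
    HasDerivAt (fun s => ∑ x, chernoffWeight P Q s x)
      (∑ x, chernoffWeight P Q t x * (Real.log (P x).toReal - Real.log (Q x).toReal)) t :=
  HasDerivAt.fun_sum fun x _ => hasDerivAt_chernoffWeight P Q x t

theorem exists_isMinOn_sum_chernoffWeight (P Q : PMF α) :
    ∃ t ∈ Set.Icc (0 : ℝ) 1,
      IsMinOn (fun s => ∑ x, chernoffWeight P Q s x) (Set.Icc 0 1) t :=
  isCompact_Icc.exists_isMinOn ⟨0, by norm_num⟩ fun t _ =>
    (hasDerivAt_sum_chernoffWeight P Q t).continuousAt.continuousWithinAt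

theorem IsMinOn.deriv_mul_sub_nonneg {f : ℝ → ℝ} {f' t s a b : ℝ}
    (hmin : IsMinOn f (Set.Icc a b) t) (hf : HasDerivAt f f' t) (ht : t ∈ Set.Icc a b)
    (hs : s ∈ Set.Icc a b) : 0 ≤ f' * (s - t) := by
  have h := hmin.localize.hasFDerivWithinAt_nonneg hf.hasFDerivAt.hasFDerivWithinAt
    (sub_mem_posTangentConeAt_of_segment_subset ((convex_Icc a b).segment_subset ht hs))
  simpa [mul_comm] using h

/-- The normalised geometric mixture, proportional to `P x ^ t * Q x ^ (1 - t)` on the common support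
of `P` and `Q`. -/
noncomputable def tilted {P Q : PMF α} (h : ∃ x, P x ≠ 0 ∧ Q x ≠ 0) (t : ℝ) : PMF α :=
  PMF.ofFintype
    (fun x => ENNReal.ofReal (chernoffWeight P Q t x / ∑ y, chernoffWeight P Q t y)) (by
      rw [← ENNReal.ofReal_sum_of_nonneg fun x _ =>
        div_nonneg (chernoffWeight_nonneg P Q t x) (sum_chernoffWeight_pos h t).le,
        ← Finset.sum_div, div_self (sum_chernoffWeight_pos h t).ne', ENNReal.ofReal_one])

theorem toReal_tilted {P Q : PMF α} (h : ∃ x, P x ≠ 0 ∧ Q x ≠ 0) (t : ℝ) (x : α) :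
    (tilted h t x).toReal = chernoffWeight P Q t x / ∑ y, chernoffWeight P Q t y :=
  ENNReal.toReal_ofReal
    (div_nonneg (chernoffWeight_nonneg P Q t x) (sum_chernoffWeight_pos h t).le)

theorem ne_zero_of_tilted_ne_zero {P Q : PMF α} (h : ∃ x, P x ≠ 0 ∧ Q x ≠ 0) {t : ℝ} {x : α}
    (hx : tilted h t x ≠ 0) : P x ≠ 0 ∧ Q x ≠ 0 := by
  refine ne_zero_of_chernoffWeight_ne_zero (t := t) fun h0 => hx ?_
  rw [tilted, PMF.ofFintype_apply, h0, zero_div, ENNReal.ofReal_zero]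

/-- With `Z` the Chernoff sum, the relative entropies of the tilted distribution are
`-log Z - (1 - t) * Z' / Z` and `-log Z + t * Z' / Z`. At a minimiser of `Z` on `[0, 1]` the
first-order condition `0 ≤ Z' * (s - t)` at `s = 0` and `s = 1` bounds both by `-log Z`. -/
theorem maxRelEntropy_tilted_le {P Q : PMF α} (h : ∃ x, P x ≠ 0 ∧ Q x ≠ 0) {t : ℝ}
    (ht : t ∈ Set.Icc (0 : ℝ) 1)
    (hmin : IsMinOn (fun s => ∑ x, chernoffWeight P Q s x) (Set.Icc 0 1) t) :
    maxRelEntropy P Q (tilted h t) ≤ chernoffFun P Q t := by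
  rw [maxRelEntropy_eq_sum (fun x hx => (ne_zero_of_tilted_ne_zero h hx).1)
    fun x hx => (ne_zero_of_tilted_ne_zero h hx).2, chernoffFun_eq_neg_log h, EReal.coe_le_coe_iff]
  have hd := hasDerivAt_sum_chernoffWeight P Q t
  have h0 := IsMinOn.deriv_mul_sub_nonneg hmin hd ht (s := 0) (by norm_num)
  have h1 := IsMinOn.deriv_mul_sub_nonneg hmin hd ht (s := 1) (by norm_num)
  have hZ := sum_chernoffWeight_pos h t
  set Z := ∑ x, chernoffWeight P Q t x with hZdef
  set Z' := ∑ x, chernoffWeight P Q t x * (Real.log (P x).toReal - Real.log (Q x).toReal) with hZ'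
  -- Both log-likelihood ratios of the tilted distribution are affine in `log (P x) - log (Q x)`,
  -- whose mean under it is `Z' / Z`; the slope `u` is `t - 1` against `P` and `t` against `Q`.
  have key : ∀ (f : α → ℝ) (u : ℝ), (∀ x, chernoffWeight P Q t x ≠ 0 →
      Real.log (chernoffWeight P Q t x / Z / f x) =
        u * (Real.log (P x).toReal - Real.log (Q x).toReal) - Real.log Z) →
      ∑ x, (tilted h t x).toReal * Real.log ((tilted h t x).toReal / f x) =
        u * Z' / Z - Real.log Z := by
    intro f u hu
    have : ∀ x, (tilted h t x).toReal * Real.log ((tilted h t x).toReal / f x) =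
        u * (chernoffWeight P Q t x * (Real.log (P x).toReal - Real.log (Q x).toReal)) / Z -
          chernoffWeight P Q t x * (Real.log Z / Z) := by
      intro x
      rw [toReal_tilted, ← hZdef]
      by_cases hx : chernoffWeight P Q t x = 0
      · simp [hx]
      · rw [hu x hx]
        ring
    simp_rw [this, Finset.sum_sub_distrib, ← Finset.sum_div, ← Finset.mul_sum, ← Finset.sum_mul,
      ← hZ', ← hZdef]
    field_simp
  have hlog : ∀ x, chernoffWeight P Q t x ≠ 0 →
      Real.log (chernoffWeight P Q t x / Z) =
        t * Real.log (P x).toReal + (1 - t) * Real.log (Q x).toReal - Real.log Z := by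
    intro x hx
    obtain ⟨hP, hQ⟩ := ne_zero_of_chernoffWeight_ne_zero hx
    have hp : 0 < (P x).toReal := ENNReal.toReal_pos hP (P.apply_ne_top x)
    have hq : 0 < (Q x).toReal := ENNReal.toReal_pos hQ (Q.apply_ne_top x)
    rw [Real.log_div hx hZ.ne', chernoffWeight, if_neg (not_or.2 ⟨hP, hQ⟩),
      Real.log_mul (by positivity) (by positivity), Real.log_rpow hp, Real.log_rpow hq]
  have hne : ∀ x, chernoffWeight P Q t x ≠ 0 → (P x).toReal ≠ 0 ∧ (Q x).toReal ≠ 0 := fun x hx =>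
    ⟨ENNReal.toReal_ne_zero.2 ⟨(ne_zero_of_chernoffWeight_ne_zero hx).1, P.apply_ne_top x⟩,
      ENNReal.toReal_ne_zero.2 ⟨(ne_zero_of_chernoffWeight_ne_zero hx).2, Q.apply_ne_top x⟩⟩
  rw [key _ (t - 1) fun x hx => by
      rw [Real.log_div (div_ne_zero hx hZ.ne') (hne x hx).1, hlog x hx]; ring,
    key _ t fun x hx => by
      rw [Real.log_div (div_ne_zero hx hZ.ne') (hne x hx).2, hlog x hx]; ring]
  refine max_le ?_ ?_
  · have : (t - 1) * Z' / Z ≤ 0 := div_nonpos_of_nonpos_of_nonneg (by linarith) hZ.le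
    linarith
  · have : t * Z' / Z ≤ 0 := div_nonpos_of_nonpos_of_nonneg (by linarith) hZ.le
    linarith

theorem isGreatest_chernoffInfo (P Q : PMF α) :
    IsGreatest (chernoffFun P Q '' Set.Icc 0 1) (chernoffInfo P Q) := by
  suffices ∃ E, IsGreatest (chernoffFun P Q '' Set.Icc 0 1) E by
    obtain ⟨E, hE⟩ := this
    rwa [chernoffInfo, hE.csSup_eq]
  by_cases h : ∃ x, P x ≠ 0 ∧ Q x ≠ 0
  · obtain ⟨t, ht, hmin⟩ := exists_isMinOn_sum_chernoffWeight P Q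
    refine ⟨chernoffFun P Q t, ⟨t, ht, rfl⟩, ?_⟩
    rintro _ ⟨s, hs, rfl⟩
    rw [chernoffFun_eq_neg_log h, chernoffFun_eq_neg_log h, EReal.coe_le_coe_iff]
    exact neg_le_neg (Real.log_le_log (sum_chernoffWeight_pos h t) (hmin hs))
  · push Not at h
    exact ⟨⊤, ⟨0, by norm_num, chernoffFun_eq_top h 0⟩, fun _ _ => le_top⟩

theorem chernoffInfo_eq_top {P Q : PMF α} (h : ∀ x, P x ≠ 0 → Q x = 0) : chernoffInfo P Q = ⊤ := by
  obtain ⟨⟨t, -, ht⟩, -⟩ := isGreatest_chernoffInfo P Q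
  rw [← ht, chernoffFun_eq_top h]

theorem hasExponent_overlap_and_isLeast (P Q : PMF α) :
    HasExponent (fun n => overlap (iid P n) (iid Q n)) (chernoffInfo P Q) ∧
      IsLeast (Set.range (maxRelEntropy P Q)) (chernoffInfo P Q) := by
  have hlower : chernoffInfo P Q ∈ lowerBounds (Set.range (maxRelEntropy P Q)) := by
    rintro _ ⟨R, rfl⟩
    exact chernoffInfo_le_maxRelEntropy P Q R
  by_cases h : ∃ x, P x ≠ 0 ∧ Q x ≠ 0
  · obtain ⟨t, ht, hmin⟩ := exists_isMinOn_sum_chernoffWeight P Q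
    have hle : maxRelEntropy P Q (tilted h t) ≤ chernoffInfo P Q :=
      (maxRelEntropy_tilted_le h ht hmin).trans (le_sSup ⟨t, ht, rfl⟩)
    exact ⟨hasExponent_overlap_of_maxRelEntropy_le
        (fun x hx => (ne_zero_of_tilted_ne_zero h hx).1)
        (fun x hx => (ne_zero_of_tilted_ne_zero h hx).2) hle,
      ⟨⟨_, hle.antisymm (chernoffInfo_le_maxRelEntropy P Q _)⟩, hlower⟩⟩
  · push Not at h
    have htop := chernoffInfo_eq_top h
    refine ⟨tendsto_const_nhds.congr' ?_, ⟨⟨P, ?_⟩, hlower⟩⟩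
    · filter_upwards [eventually_ne_atTop 0] with n hn
      have := chernoffInfo_le_exponent P Q hn
      rw [htop, top_le_iff] at this
      rw [htop, this]
    · have := chernoffInfo_le_maxRelEntropy P Q P
      rw [htop, top_le_iff] at this
      rw [htop, this]

end Tilting

/-! ### A pair on two points with strict inequality -/

section Example

/-- The pair `(3/4, 1/4)`, `(1/4, 3/4)` works: the two terms of its Chernoff sum are `3 ^ t / 4` and
`3 ^ (1 - t) / 4`, so for every `t` in `[0, 1]` both are at least `1/4` and one of them is larger,
while the overlap is `1/2`. -/
theorem exists_chernoffInfo_lt_neg_log_overlap :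
    ∃ P Q : PMF Bool, P ≠ Q ∧ chernoffInfo P Q < -ENNReal.log (overlap P Q) := by
  let μ : Bool → PMF Bool := fun b => PMF.ofFintype
    (fun c => ENNReal.ofReal (if b = c then 3 / 4 else 1 / 4)) (by
      rw [← ENNReal.ofReal_sum_of_nonneg fun c _ => by positivity]
      cases b <;> norm_num)
  have hμ : ∀ b c, (μ b c).toReal = if b = c then 3 / 4 else 1 / 4 := fun b c =>
    ENNReal.toReal_ofReal (by positivity)
  have hμ0 : ∀ b c, μ b c ≠ 0 := fun b c h => by
    have := hμ b c
    rw [h, ENNReal.toReal_zero] at this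
    split_ifs at this <;> norm_num at this
  refine ⟨μ true, μ false, fun h => ?_, ?_⟩
  · have := (hμ true true).symm.trans (h ▸ hμ false true)
    norm_num at this
  · obtain ⟨⟨t, ht, heq⟩, -⟩ := isGreatest_chernoffInfo (μ true) (μ false)
    rw [← heq, chernoffFun_eq]
    refine EReal.neg_lt_neg_iff.2 (ENNReal.log_lt_log ?_)
    have hover : overlap (μ true) (μ false) = ENNReal.ofReal (1 / 2) := by
      rw [← ENNReal.ofReal_toReal
        (ne_top_of_le_ne_top ENNReal.one_ne_top (overlap_le_one (μ true) (μ false))),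
        toReal_overlap]
      congr 1
      simp_rw [hμ]
      norm_num
    have hterm : ∀ s : ℝ, (3 / 4 : ℝ) ^ s * (1 / 4 : ℝ) ^ (1 - s) = 3 ^ s / 4 := by
      intro s
      rw [Real.div_rpow (by norm_num) (by norm_num), Real.div_rpow (by norm_num) (by norm_num),
        Real.one_rpow, Real.rpow_sub (by norm_num), Real.rpow_one]
      field_simp
    have hterm' : (1 / 4 : ℝ) ^ t * (3 / 4 : ℝ) ^ (1 - t) = 3 ^ (1 - t) / 4 := by
      rw [← hterm, sub_sub_cancel, mul_comm]
    rw [hover, chernoffSum_eq_ofReal]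
    refine (ENNReal.ofReal_lt_ofReal_iff_of_nonneg (by norm_num)).2 ?_
    simp_rw [chernoffWeight, hμ0, Fintype.sum_bool, hμ]
    simp only [or_self, if_false, if_true, reduceCtorEq]
    rw [hterm, hterm']
    have h1 : (1 : ℝ) ≤ 3 ^ t := Real.one_le_rpow (by norm_num) ht.1
    have h2 : (1 : ℝ) ≤ 3 ^ (1 - t) := Real.one_le_rpow (by norm_num) (by linarith [ht.2])
    rcases ht.1.eq_or_lt with h | h
    · rw [← h]
      norm_num
    · have : (1 : ℝ) < 3 ^ t := Real.one_lt_rpow (by norm_num) h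
      linarith

end Example

end MaximalCoupling

open MaximalCoupling
theorem mainTheorem3 {α : Type*} [Fintype α] (P Q : PMF α) (hPQ : P ≠ Q) :
    -- the maximum defining `M(P ^ n, Q ^ n)` is attained
    (∀ n : ℕ, IsGreatest (eqProb '' couplings (iid P n) (iid Q n))
      (maxEqProb (iid P n) (iid Q n))) ∧
    -- exponential decay
    (∃ c : ℝ, 0 < c ∧ ∃ C : ℝ, ∀ n : ℕ,
      maxEqProb (iid P n) (iid Q n) ≤ ENNReal.ofReal (C * Real.exp (-(c * n)))) ∧
    -- the exponent is the minimum of `max {D(R ‖ P), D(R ‖ Q)}`, which is the Chernoff information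
    (∃ E : EReal,
      HasExponent (fun n => maxEqProb (iid P n) (iid Q n)) E ∧
      IsLeast (Set.range (maxRelEntropy P Q)) E ∧
      E = chernoffInfo P Q) ∧
    -- the maximum defining the Chernoff information is attained
    IsGreatest (chernoffFun P Q '' Set.Icc 0 1) (chernoffInfo P Q) ∧
    -- powers of couplings are couplings of the powers
    (∀ π ∈ couplings P Q, ∀ n : ℕ, prodCoupling π n ∈ couplings (iid P n) (iid Q n)) ∧
    -- powers of a maximal coupling have exponent `-log (1 - |P - Q|)`
    (∀ π ∈ couplings P Q, eqProb π = maxEqProb P Q →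
      HasExponent (fun n => eqProb (prodCoupling π n))
        (-ENNReal.log (ENNReal.ofReal (1 - tvDist P Q)))) ∧
    -- this is the best exponent of a product coupling
    IsLeast {E : EReal | ∃ π ∈ couplings P Q, HasExponent (fun n => eqProb (prodCoupling π n)) E}
      (-ENNReal.log (ENNReal.ofReal (1 - tvDist P Q))) ∧
    -- it is no better than the optimal exponent, and in general strictly worse
    chernoffInfo P Q ≤ -ENNReal.log (ENNReal.ofReal (1 - tvDist P Q)) ∧
    (∃ P' Q' : PMF Bool, P' ≠ Q' ∧
      chernoffInfo P' Q' < -ENNReal.log (ENNReal.ofReal (1 - tvDist P' Q'))) := by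
  simp_rw [maxEqProb_eq_overlap, ← overlap_eq_ofReal_one_sub_tvDist]
  have hexp := hasExponent_overlap_and_isLeast P Q
  refine ⟨fun n => isGreatest_overlap _ _, exists_overlap_iid_le_exp hPQ,
    ⟨_, hexp.1, hexp.2, rfl⟩, isGreatest_chernoffInfo P Q,
    fun π hπ n => prodCoupling_mem_couplings hπ n, fun π _ hπ => ?_, ⟨?_, ?_⟩,
    chernoffInfo_le_neg_log_overlap P Q, exists_chernoffInfo_lt_neg_log_overlap⟩
  · rw [← hπ]
    exact hasExponent_eqProb_prodCoupling π
  · refine ⟨maximalCoupling P Q, maximalCoupling_mem_couplings P Q, ?_⟩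
    rw [← eqProb_maximalCoupling P Q]
    exact hasExponent_eqProb_prodCoupling _
  · rintro E ⟨π, hπ, hE⟩
    rw [tendsto_nhds_unique hE (hasExponent_eqProb_prodCoupling π)]
    exact EReal.neg_le_neg_iff.2 (ENNReal.log_le_log (eqProb_le_overlap hπ))
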